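/- Let $\Omega$ be a finite set and let $(\omega_t)_{t\ge 0}$ be a time-homogeneous continuous-time Markov process on $\Omega$, with right-continuous paths having left limits, with transition probabilities $p_t(\omega'\mid\omega)$ and infinitesimal generator $\mathbf G$, $G^{\omega'}_{\omega}=\langle\omega'|\mathbf G|\omega\rangle=\lim_{h\downarrow 0}\bigl(p_h(\omega'\mid\omega)-\delta_{\omega}^{\omega'}\bigr)/h$, acting on the real Hilbert space $\mathcal H$ with orthonormal basis $\{|\omega\rangle\}_{\omega\in\Omega}$. Let $\widetilde{\mathcal H}$ have orthonormal basis $\{|\omega'\omega\rangle\}_{\omega',\omega\in\Omega}$. Let $\widetilde{\mathbf G}:\mathcal H\to\widetilde{\mathcal H}$ be the linear map $\widetilde{\mathbf G}|\omega\rangle=\sum_{\omega'}G^{\omega'}_{\omega}|\omega'\omega\rangle$, and let $\widetilde{\mathbf L}:\widetilde{\mathcal H}\to\mathbb R$ be the linear functional with $\widetilde{\mathbf L}|\omega'\omega\rangle=-\log G^{\omega'}_{\omega}$ for $\omega'\ne\omega$ and $\widetilde{\mathbf L}|\omega\omega\rangle=0$; transitions with $G^{\omega'}_\omega=0$ contribute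 nothing (convention $0\log 0=0$). For a path with jumps at times $t_1<\dots<t_k$ in $(0,T]$, the $i$-th one going from $\omega_{t_i-}$ to $\omega_{t_i}$, the integrated Lagrangian is $$\int_0^T L\,dt=-\int_0^T G^{\omega_t}_{\omega_t}\,dt-\sum_{i=1}^k\log G^{\omega_{t_i}}_{\omega_{t_i-}}.$$ Assume a constant total jump rate: there is $K>0$ with $|G^{\omega}_{\omega}|=K$ for all $\omega$. Then: 1. For every $\omega$, $\omega'\mapsto G^{\omega'}_{\omega}/K$ is a probability distribution on $\{\omega':\omega'\neq\omega\}$; let $H_\omega=-\sum_{\omega'\ne\omega}\frac{G^{\omega'}_\omega}{K}\log\frac{G^{\omega'}_\omega}{K}$ be its Shannon entropy. 2. For every $\omega$, $\widetilde{\mathbf L}\widetilde{\mathbf G}|\omega\rangle=-K\log K+K\,H_\omega$. 3. For every $T\ge 0$ and every $\omega$ with $\mathbb P(\omega_0=\omega)>0$, the integrated Lagrangian is integrable conditionally on $\omega_0=\omega$, and $$\mathbb E\Bigl[\int_0^T L\,dt\Bigm|\omega_0=\omega\Bigr]\ \ge\ KT(1-\log K).$$ 4. Call a configuration $\omega$ deterministic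 if there is exactly one $\omega'\ne\omega$ with $G^{\omega'}_{\omega}>0$. If all configurations are deterministic, equality holds in 3. If $T>0$, equality holds in 3 for a given $\omega$ if and only if every configuration reachable from $\omega$ by finitely many (possibly zero) jumps of positive rate is deterministic. In particular, if $T>0$ and $\mathbb P(\omega_0=\omega)>0$ for all $\omega$, equality holds for all $\omega$ if and only if all configurations are deterministic. -/

import Mathlib

open Set Filter Topology MeasureTheory ProbabilityTheory
open scoped NNReal

namespace StochasticField

noncomputable section

/-! Vectors and operators over a finite configuration set. -/

/-- The real Hilbert space with orthonormal basis `|ω⟩` indexed by the finite set `S`. -/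
abbrev Hilb (S : Type*) [Fintype S] := EuclideanSpace ℝ S

/-- The space `H(S × S)`; its basis vector `|ω'ω⟩` is `ket (ω', ω)`, the new configuration
standing first. -/
abbrev LiftedHilb (S : Type*) [Fintype S] := EuclideanSpace ℝ (S × S)

/-- The basis vector `|ω⟩`. -/
def ket {S : Type*} [Fintype S] [DecidableEq S] (ω : S) : Hilb S :=
  EuclideanSpace.single ω 1

/-- The functional `⟨ω|`. -/
def bra {S : Type*} [Fintype S] [DecidableEq S] (ω : S) : Hilb S →L[ℝ] ℝ :=
  innerSL ℝ (ket ω)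

/-- The matrix element `⟨ω'| G |ω⟩`, for a generator the rate of jumping from `ω` to `ω'`. -/
def elem {S : Type*} [Fintype S] [DecidableEq S] (G : Hilb S →L[ℝ] Hilb S) (ω' ω : S) : ℝ :=
  bra ω' (G (ket ω))

/-- The operator sending `|ω⟩` to `|ω'ω⟩` and every other basis vector to `0`. -/
def actionOp {S : Type*} [Fintype S] [DecidableEq S] (ω' ω : S) : Hilb S →L[ℝ] LiftedHilb S :=
  (bra ω).smulRight (ket (ω', ω))

/-- The lift `∑ G^{ω'}_ω A^ω_{ω'}` of `G`. -/
def liftedGenerator {S : Type*} [Fintype S] [DecidableEq S] (G : Hilb S →L[ℝ] Hilb S) :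
    Hilb S →L[ℝ] LiftedHilb S :=
  ∑ ω : S, ∑ ω' : S, elem G ω' ω • actionOp ω' ω

/-- The functional with `|ω'ω⟩ ↦ -log G^{ω'}_ω` for `ω' ≠ ω` and `|ωω⟩ ↦ 0`.  At transitions of
rate zero it takes the value `-Real.log 0 = 0`; applied to `liftedGenerator G` this is the
convention `0 log 0 = 0`. -/
def lagrangianOp {S : Type*} [Fintype S] [DecidableEq S] (G : Hilb S →L[ℝ] Hilb S) :
    LiftedHilb S →L[ℝ] ℝ :=
  ∑ ω : S, ∑ ω' : S, (if ω' = ω then 0 else -Real.log (elem G ω' ω)) • bra (ω', ω)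

/-- Shannon entropy of the jump distribution `ω' ↦ G^{ω'}_ω / K` on `{ω' | ω' ≠ ω}`. -/
def jumpEntropy {S : Type*} [Fintype S] [DecidableEq S] (G : Hilb S →L[ℝ] Hilb S) (K : ℝ)
    (ω : S) : ℝ :=
  -∑ ω' ∈ Finset.univ.erase ω, elem G ω' ω / K * Real.log (elem G ω' ω / K)

/-- `ω` can jump to `ω'`. -/
def CanJump {S : Type*} [Fintype S] [DecidableEq S] (G : Hilb S →L[ℝ] Hilb S) (ω ω' : S) : Prop :=
  ω' ≠ ω ∧ 0 < elem G ω' ω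

/-- There is exactly one configuration that `ω` can jump to. -/
def JumpsDeterministically {S : Type*} [Fintype S] [DecidableEq S] (G : Hilb S →L[ℝ] Hilb S)
    (ω : S) : Prop :=
  ∃! ω', CanJump G ω ω'

/-! Time-homogeneous Markov dynamics in continuous time. -/

/-- `p t ω' ω` is a transition function: the probability of being in `ω'` a time `t` after
being in `ω`. -/
structure IsTransitionFunction {S : Type*} [Fintype S] [DecidableEq S]
    (p : ℝ≥0 → S → S → ℝ) : Prop where
  nonneg : ∀ t ω' ω, 0 ≤ p t ω' ω
  sum_eq_one : ∀ t ω, ∑ ω', p t ω' ω = 1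
  zero : ∀ ω' ω, p 0 ω' ω = if ω' = ω then 1 else 0
  chapman_kolmogorov : ∀ s t ω' ω, p (s + t) ω' ω = ∑ ω'', p s ω' ω'' * p t ω'' ω

/-- `G` is the infinitesimal generator of `p`. -/
def IsGenerator {S : Type*} [Fintype S] [DecidableEq S] (p : ℝ≥0 → S → S → ℝ)
    (G : Hilb S →L[ℝ] Hilb S) : Prop :=
  ∀ ω' ω, Tendsto (fun h : ℝ≥0 => (p h ω' ω - if ω' = ω then 1 else 0) / (h : ℝ)) (𝓝[>] 0)
    (𝓝 (elem G ω' ω))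

/-- Right-continuous path with left limits; as `S` is finite and discrete, such a path jumps only
finitely often in bounded time. -/
def IsJumpPath {S : Type*} [TopologicalSpace S] (w : ℝ≥0 → S) : Prop :=
  ∀ t, ContinuousWithinAt w (Ici t) t ∧ ∃ l, Tendsto w (𝓝[<] t) (𝓝 l)

/-- `X` is, under `μ`, a Markov jump process with transition function `p` and some initial law. -/
structure IsMarkovJumpProcess {S : Type*} [Fintype S] [TopologicalSpace S] [MeasurableSpace S]
    {E : Type*} [MeasurableSpace E] (p : ℝ≥0 → S → S → ℝ) (X : ℝ≥0 → E → S) (μ : Measure E) :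
    Prop where
  measurable : ∀ t, Measurable (X t)
  paths : ∀ᵐ x ∂μ, IsJumpPath fun t => X t x
  markov : ∀ (n : ℕ) (t : Fin (n + 1) → ℝ≥0) (a : Fin (n + 1) → S), Monotone t →
    μ.real {x | ∀ i, X (t i) x = a i} =
      μ.real {x | X (t 0) x = a 0} *
        ∏ i : Fin n, p (t i.succ - t i.castSucc) (a i.succ) (a i.castSucc)

/-! The Lagrangian along a path. -/

/-- The times in `(0, T]` at which the path `w` jumps, from `leftLim w t` to `w t`. -/
def jumpTimes {S : Type*} [TopologicalSpace S] (w : ℝ≥0 → S) (T : ℝ≥0) : Set ℝ≥0 :=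
  {t | t ∈ Ioc 0 T ∧ w t ≠ Function.leftLim w t}

/-- The integral over `[0, T]` of `-G^{ω_t}_{ω_t} - δ(ω_t⁺ ≠ ω_t) log G^{ω_t⁺}_{ω_t}` along the
path `w`: the unit impulse turns the second term into a sum over the jumps, where the
configurations just before and just after a jump at `t` are `leftLim w t` and `w t`. -/
def lagrangianIntegral {S : Type*} [Fintype S] [DecidableEq S] [TopologicalSpace S]
    (G : Hilb S →L[ℝ] Hilb S) (T : ℝ≥0) (w : ℝ≥0 → S) : ℝ :=
  (∫ t in (0 : ℝ)..T, -elem G (w t.toNNReal) (w t.toNNReal)) -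
    ∑ᶠ t ∈ jumpTimes w T, Real.log (elem G (w t) (Function.leftLim w t))

/-- `𝔼[∫₀ᵀ L dt | ω₀ = ω]`. -/
def expectedLagrangian {S : Type*} [Fintype S] [DecidableEq S] [TopologicalSpace S]
    {E : Type*} [MeasurableSpace E] (G : Hilb S →L[ℝ] Hilb S) (X : ℝ≥0 → E → S) (μ : Measure E)
    (T : ℝ≥0) (ω : S) : ℝ :=
  ∫ x, lagrangianIntegral G T (fun t => X t x) ∂(ProbabilityTheory.cond μ {x | X 0 x = ω})

end

end StochasticField

/-!
Along any path the diagonal part of the Lagrangian integrates to `K * T`, so only the mean of the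
sum over jumps, `∑ log G`, has to be computed. The jump sum is the pointwise limit of the sums
obtained by sampling the path on dyadic meshes (`IsJumpPath.eventually_stepSum_eq`), because a
right-continuous path with left limits in a discrete space has, by compactness, at most one jump in
each sufficiently short interval. The sampled sums are dominated by the total number of jumps, which
is integrable: the numbers of changes seen on the meshes have means converging to `K * T`.
Hence expectation and limit can be exchanged (`IsMarkovJumpProcess.tendsto_integral_stepSum`).

The Markov property gives the mean of a sampled sum in terms of the transition function, and
`p_h = δ + h G + o(h)` turns it into a Riemann sum of
`∫₀ᵀ ∑ a, p_t(a | ω) ∑ b ≠ a, G^b_a log G^b_a dt`. The inner sum is `K log K - K H_a` by the entropy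
identity `sum_jumpCost_mul_elem`, so the excess of the expected Lagrangian over `K T (1 - log K)` is
the limit of `K` times Riemann sums of `∫₀ᵀ ∑ a, p_t(a | ω) H_a dt`
(`IsMarkovJumpProcess.tendsto_occupationSum_jumpEntropy`).

Entropies are nonnegative, which is the inequality. They vanish exactly at the configurations that
jump deterministically (`jumpEntropy_eq_zero_iff`); configurations that are not reachable have
probability zero at all times (`IsTransitionFunction.eq_zero_of_not_reflTransGen`), while a
reachable one has probability bounded below on `[T / 2, T]` (`exists_le_occupationSum`). This
settles the case of equality. Working with Riemann sums avoids any regularity theory for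
`t ↦ p_t`.
-/

namespace StochasticField

section Rates

variable {S : Type*} [Fintype S] [DecidableEq S]

/-! ### The lifted generator and the Lagrangian functional on basis vectors -/

lemma bra_ket (a b : S) : bra a (ket b) = if a = b then 1 else 0 := by
  simp [bra, ket, EuclideanSpace.inner_single_left, PiLp.single_apply]

lemma liftedGenerator_ket (G : Hilb S →L[ℝ] Hilb S) (a : S) :
    liftedGenerator G (ket a) = ∑ b, elem G b a • ket (b, a) := by
  simp only [liftedGenerator, actionOp, _root_.sum_apply,
    _root_.smul_apply, ContinuousLinearMap.smulRight_apply, bra_ket]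
  rw [Finset.sum_eq_single a] <;> simp +contextual

lemma lagrangianOp_ket (G : Hilb S →L[ℝ] Hilb S) (a b : S) :
    lagrangianOp G (ket (b, a)) = if b = a then 0 else -Real.log (elem G b a) := by
  simp only [lagrangianOp, _root_.sum_apply,
    _root_.smul_apply, bra_ket, Prod.mk.injEq]
  rw [Finset.sum_eq_single a _ (by simp), Finset.sum_eq_single b _ (by simp)]
  · simp
  · simp +contextual
  · simp +contextual

/-- The contribution to the action of a jump from `a` to `b`, up to sign; staying put is free. -/
noncomputable def jumpCost (G : Hilb S →L[ℝ] Hilb S) (a b : S) : ℝ :=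
  if b = a then 0 else Real.log (elem G b a)

lemma jumpCost_self (G : Hilb S →L[ℝ] Hilb S) (a : S) : jumpCost G a a = 0 := by
  simp [jumpCost]

lemma lagrangianOp_liftedGenerator_ket (G : Hilb S →L[ℝ] Hilb S) (a : S) :
    lagrangianOp G (liftedGenerator G (ket a)) = -∑ b, jumpCost G a b * elem G b a := by
  simp only [liftedGenerator_ket, map_sum, map_smul, lagrangianOp_ket, smul_eq_mul, jumpCost,
    ← Finset.sum_neg_distrib]
  refine Finset.sum_congr rfl fun b _ => ?_
  split_ifs <;> ring

/-! ### Rates of a transition function -/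

variable {p : ℝ≥0 → S → S → ℝ} {G : Hilb S →L[ℝ] Hilb S} {K : ℝ}

lemma IsTransitionFunction.le_one (hp : IsTransitionFunction p) (t : ℝ≥0) (b a : S) :
    p t b a ≤ 1 := by
  rw [← hp.sum_eq_one t a]
  exact Finset.single_le_sum (f := fun b => p t b a) (fun b _ => hp.nonneg t b a)
    (Finset.mem_univ b)

lemma IsTransitionFunction.mul_le_add (hp : IsTransitionFunction p) (s t : ℝ≥0) (c b a : S) :
    p s c b * p t b a ≤ p (s + t) c a := by
  rw [hp.chapman_kolmogorov]
  exact Finset.single_le_sum (f := fun b => p s c b * p t b a)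
    (fun b _ => mul_nonneg (hp.nonneg _ _ _) (hp.nonneg _ _ _)) (Finset.mem_univ b)

lemma IsTransitionFunction.pow_le (hp : IsTransitionFunction p) (n : ℕ) (h : ℝ≥0) (a : S) :
    p h a a ^ n ≤ p (n * h) a a := by
  induction n with
  | zero => simp [hp.zero]
  | succ n ih =>
    refine le_trans ?_ ((hp.mul_le_add (n * h) h a a a).trans_eq (by push_cast; ring_nf))
    rw [pow_succ]
    exact mul_le_mul_of_nonneg_right ih (hp.nonneg _ _ _)

lemma IsGenerator.tendsto_of_ne (hG : IsGenerator p G) {a b : S} (hab : b ≠ a) :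
    Tendsto (fun h : ℝ≥0 => p h b a / (h : ℝ)) (𝓝[>] 0) (𝓝 (elem G b a)) := by
  simpa [hab] using hG b a

lemma IsGenerator.elem_nonneg (hp : IsTransitionFunction p) (hG : IsGenerator p G) {a b : S}
    (hab : b ≠ a) : 0 ≤ elem G b a :=
  ge_of_tendsto' (hG.tendsto_of_ne hab) fun h => div_nonneg (hp.nonneg _ _ _) h.2

lemma IsGenerator.elem_self_nonpos (hp : IsTransitionFunction p) (hG : IsGenerator p G) (a : S) :
    elem G a a ≤ 0 :=
  le_of_tendsto' (hG a a) fun h => by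
    simpa using div_nonpos_of_nonpos_of_nonneg (sub_nonpos.2 (hp.le_one h a a)) h.2

lemma IsGenerator.sum_elem (hp : IsTransitionFunction p) (hG : IsGenerator p G) (a : S) :
    ∑ b, elem G b a = 0 := by
  refine tendsto_nhds_unique (tendsto_finsetSum _ fun b _ => hG b a) ?_
  simp [← Finset.sum_div, hp.sum_eq_one]

lemma IsGenerator.elem_self (hp : IsTransitionFunction p) (hG : IsGenerator p G)
    (hGK : ∀ a, |elem G a a| = K) (a : S) : elem G a a = -K := by
  rw [← hGK a, abs_of_nonpos (hG.elem_self_nonpos hp a), neg_neg]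

lemma IsGenerator.sum_erase (hp : IsTransitionFunction p) (hG : IsGenerator p G)
    (hGK : ∀ a, |elem G a a| = K) (a : S) : ∑ b ∈ Finset.univ.erase a, elem G b a = K := by
  have := Finset.add_sum_erase Finset.univ (fun b => elem G b a) (Finset.mem_univ a)
  rw [hG.sum_elem hp a, hG.elem_self hp hGK a] at this
  linarith

lemma IsGenerator.tendsto_self (hG : IsGenerator p G) (a : S) :
    Tendsto (fun h : ℝ≥0 => p h a a) (𝓝[>] 0) (𝓝 1) := by
  have h1 : Tendsto (fun h : ℝ≥0 => (h : ℝ)) (𝓝[>] 0) (𝓝 0) :=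
    (NNReal.continuous_coe.tendsto' 0 0 rfl).mono_left nhdsWithin_le_nhds
  have h2 := ((hG a a).mul h1).add_const 1
  rw [mul_zero, zero_add] at h2
  refine h2.congr' ?_
  filter_upwards [self_mem_nhdsWithin] with h hh
  have : (h : ℝ) ≠ 0 := by exact_mod_cast (ne_of_gt hh)
  simp [this]

/-! ### The entropy of the jump distribution -/

lemma jumpProb_nonneg (hp : IsTransitionFunction p) (hG : IsGenerator p G) (hK : 0 < K) {a b : S}
    (hab : b ≠ a) : 0 ≤ elem G b a / K :=
  div_nonneg (hG.elem_nonneg hp hab) hK.le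

lemma sum_jumpProb (hp : IsTransitionFunction p) (hG : IsGenerator p G) (hK : 0 < K)
    (hGK : ∀ a, |elem G a a| = K) (a : S) :
    ∑ b ∈ Finset.univ.erase a, elem G b a / K = 1 := by
  rw [← Finset.sum_div, hG.sum_erase hp hGK, div_self hK.ne']

lemma jumpProb_le_one (hp : IsTransitionFunction p) (hG : IsGenerator p G) (hK : 0 < K)
    (hGK : ∀ a, |elem G a a| = K) {a b : S} (hab : b ≠ a) : elem G b a / K ≤ 1 := by
  rw [← sum_jumpProb hp hG hK hGK a]
  exact Finset.single_le_sum (f := fun b => elem G b a / K)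
    (fun c hc => jumpProb_nonneg hp hG hK (Finset.ne_of_mem_erase hc)) (by simpa using hab)

lemma jumpEntropy_eq (G : Hilb S →L[ℝ] Hilb S) (K : ℝ) (a : S) :
    jumpEntropy G K a = ∑ b ∈ Finset.univ.erase a, Real.negMulLog (elem G b a / K) := by
  simp only [jumpEntropy, Real.negMulLog, neg_mul, Finset.sum_neg_distrib]

lemma jumpEntropy_nonneg (hp : IsTransitionFunction p) (hG : IsGenerator p G) (hK : 0 < K)
    (hGK : ∀ a, |elem G a a| = K) (a : S) : 0 ≤ jumpEntropy G K a := by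
  rw [jumpEntropy_eq]
  exact Finset.sum_nonneg fun b hb => Real.negMulLog_nonneg
    (jumpProb_nonneg hp hG hK (Finset.ne_of_mem_erase hb))
    (jumpProb_le_one hp hG hK hGK (Finset.ne_of_mem_erase hb))

lemma jumpEntropy_eq_zero_iff (hp : IsTransitionFunction p) (hG : IsGenerator p G) (hK : 0 < K)
    (hGK : ∀ a, |elem G a a| = K) (a : S) :
    jumpEntropy G K a = 0 ↔ JumpsDeterministically G a := by
  have hsum := sum_jumpProb hp hG hK hGK a
  rw [jumpEntropy_eq, Finset.sum_eq_zero_iff_of_nonneg fun b hb => Real.negMulLog_nonneg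
    (jumpProb_nonneg hp hG hK (Finset.ne_of_mem_erase hb))
    (jumpProb_le_one hp hG hK hGK (Finset.ne_of_mem_erase hb))]
  constructor
  · intro h
    -- every jump probability is `0` or `1`, since `-x log x` vanishes nowhere else on `[0, 1]`
    have h01 : ∀ b, CanJump G a b → elem G b a / K = 1 := fun b ⟨hb, hpos⟩ => by
      have h0 := h b (by simpa using hb)
      have hx : 0 < elem G b a / K := div_pos hpos hK
      rw [Real.negMulLog, neg_mul, neg_eq_zero, mul_eq_zero, Real.log_eq_zero] at h0
      rcases h0 with h0 | h0 | h0 | h0 <;> linarith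
    obtain ⟨b, hb, hbpos⟩ : ∃ b ∈ Finset.univ.erase a, 0 < elem G b a / K :=
      Finset.exists_lt_of_sum_lt (by simp [hsum])
    have hba := Finset.ne_of_mem_erase hb
    have hjump : CanJump G a b := ⟨hba, by simpa [hK] using (div_pos_iff_of_pos_right hK).1 hbpos⟩
    refine ⟨b, hjump, fun c hc => by_contra fun hcb => ?_⟩
    have h2 : elem G b a / K + elem G c a / K ≤ 1 := by
      rw [← hsum]
      exact Finset.add_le_sum (f := fun b => elem G b a / K)
        (fun d hd => jumpProb_nonneg hp hG hK (Finset.ne_of_mem_erase hd)) hb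
        (by simpa using hc.1) (Ne.symm hcb)
    rw [h01 b hjump, h01 c hc] at h2
    norm_num at h2
  · rintro ⟨b, hb, huniq⟩ c hc
    have hz : ∀ d ∈ Finset.univ.erase a, d ≠ b → elem G d a / K = 0 := fun d hd hdb => by
      have hda := Finset.ne_of_mem_erase hd
      have := hG.elem_nonneg hp hda
      rcases this.eq_or_lt with h0 | h0
      · simp [← h0]
      · exact absurd (huniq d ⟨hda, h0⟩) hdb
    by_cases hcb : c = b
    · rw [Finset.sum_eq_single_of_mem b (by simpa using hb.1) hz] at hsum
      rw [hcb, hsum, Real.negMulLog_one]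
    · rw [hz c hc hcb, Real.negMulLog_zero]

/-- Splitting `log G = log (G / K) + log K` turns the mean cost of a jump into an entropy. -/
lemma sum_jumpCost_mul_elem (hp : IsTransitionFunction p) (hG : IsGenerator p G) (hK : 0 < K)
    (hGK : ∀ a, |elem G a a| = K) (a : S) :
    ∑ b, jumpCost G a b * elem G b a = K * Real.log K - K * jumpEntropy G K a := by
  have h : ∀ b ∈ Finset.univ.erase a, jumpCost G a b * elem G b a =
      elem G b a * Real.log K - K * Real.negMulLog (elem G b a / K) := fun b hb => by
    have hba := Finset.ne_of_mem_erase hb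
    rw [jumpCost, if_neg hba, Real.negMulLog]
    rcases (hG.elem_nonneg hp hba).eq_or_lt with h0 | h0
    · simp [← h0]
    · rw [Real.log_div h0.ne' hK.ne']
      field_simp
      ring
  rw [← Finset.add_sum_erase _ _ (Finset.mem_univ a), jumpCost_self, zero_mul, zero_add,
    Finset.sum_congr rfl h, Finset.sum_sub_distrib, ← Finset.sum_mul, ← Finset.mul_sum,
    hG.sum_erase hp hGK, ← jumpEntropy_eq]

/-! ### Accessible configurations -/

lemma IsTransitionFunction.exists_forall_le_self (hp : IsTransitionFunction p)
    (hG : IsGenerator p G) (T : ℝ≥0) (a : S) : ∃ ε > 0, ∀ t ≤ T, ε ≤ p t a a := by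
  have h1 : ∀ᶠ h in 𝓝[>] (0 : ℝ≥0), 1 / 2 < p h a a :=
    (hG.tendsto_self a).eventually_const_lt (by norm_num)
  obtain ⟨δ, hδ, h2⟩ := (mem_nhdsGT_iff_exists_Ioo_subset).1 h1
  -- staying put during `n` steps of length `t / n < δ` has probability at least `(1 / 2) ^ n`
  obtain ⟨n, hn⟩ := exists_nat_gt (T / δ)
  have hn0 : (0 : ℝ≥0) < n := zero_le.trans_lt hn
  refine ⟨(1 / 2) ^ n, by positivity, fun t ht => ?_⟩
  have h3 : 1 / 2 ≤ p (t / n) a a := by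
    rcases (zero_le (a := t)).eq_or_lt with h0 | h0
    · rw [← h0, zero_div, hp.zero]; norm_num
    · refine (h2 ⟨div_pos h0 hn0, ?_⟩).le
      rw [div_lt_iff₀ hn0]
      rw [div_lt_iff₀ hδ, mul_comm] at hn
      exact ht.trans_lt hn
  calc (1 / 2 : ℝ) ^ n ≤ p (t / n) a a ^ n := by gcongr
    _ ≤ p (n * (t / n)) a a := hp.pow_le _ _ _
    _ = p t a a := by rw [mul_div_cancel₀ _ hn0.ne']

lemma IsTransitionFunction.pos_of_reflTransGen (hp : IsTransitionFunction p)
    (hG : IsGenerator p G) {a b : S} (hab : Relation.ReflTransGen (CanJump G) a b) {t : ℝ≥0}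
    (ht : 0 < t) : 0 < p t b a := by
  induction hab generalizing t with
  | refl =>
    obtain ⟨ε, hε, h⟩ := hp.exists_forall_le_self hG t a
    exact hε.trans_le (h t le_rfl)
  | @tail b c _ hbc ih =>
    have h1 := (hG.tendsto_of_ne hbc.1).eventually_const_lt hbc.2
    obtain ⟨h, ⟨hpos, hlt⟩, h2⟩ :=
      ((eventually_mem_set.2 (Ioo_mem_nhdsGT ht)).and h1).exists
    have h3 : 0 < p h c b := by
      by_contra hneg
      exact h2.not_ge (div_nonpos_of_nonpos_of_nonneg (not_lt.1 hneg) h.2)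
    have h4 := hp.mul_le_add h (t - h) c b a
    rw [add_tsub_cancel_of_le hlt.le] at h4
    exact (mul_pos h3 (ih (tsub_pos_of_lt hlt))).trans_le h4

/-- Mass leaks out of a set closed under jumps at rate `0`: over `n` steps of length `t / n` at
most `n * o(t / n)` gets out. -/
lemma IsTransitionFunction.eq_zero_of_not_reflTransGen (hp : IsTransitionFunction p)
    (hG : IsGenerator p G) {a b : S} (hab : ¬Relation.ReflTransGen (CanJump G) a b) (t : ℝ≥0) :
    p t b a = 0 := by
  classical
  let R := Finset.univ.filter fun c => Relation.ReflTransGen (CanJump G) a c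
  let v : ℝ≥0 → ℝ := fun h => ∑ c ∈ R, ∑ d ∈ Rᶜ, p h d c
  let u : ℝ≥0 → ℝ := fun s => ∑ d ∈ Rᶜ, p s d a
  have hv : Tendsto (fun h => v h / h) (𝓝[>] 0) (𝓝 0) := by
    have : Tendsto (fun h => ∑ c ∈ R, ∑ d ∈ Rᶜ, p h d c / h) (𝓝[>] 0)
        (𝓝 (∑ c ∈ R, ∑ d ∈ Rᶜ, (0 : ℝ))) := by
      refine tendsto_finsetSum _ fun c hc => tendsto_finsetSum _ fun d hd => ?_
      simp only [R, Finset.mem_compl, Finset.mem_filter, Finset.mem_univ, true_and] at hc hd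
      have hdc : d ≠ c := by rintro rfl; exact hd hc
      have h0 : elem G d c = 0 := le_antisymm
        (not_lt.1 fun hpos => hd (hc.tail ⟨hdc, hpos⟩)) (hG.elem_nonneg hp hdc)
      simpa [h0] using hG.tendsto_of_ne hdc
    simpa [v, Finset.sum_div] using this
  have hstep : ∀ h s, u (h + s) ≤ v h + u s := fun h s => by
    calc u (h + s) = ∑ c, (∑ d ∈ Rᶜ, p h d c) * p s c a := by
          simp only [u, hp.chapman_kolmogorov]
          rw [Finset.sum_comm]
          simp_rw [Finset.sum_mul]
      _ = ∑ c ∈ R, (∑ d ∈ Rᶜ, p h d c) * p s c a + ∑ c ∈ Rᶜ, (∑ d ∈ Rᶜ, p h d c) * p s c a :=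
          (Finset.sum_add_sum_compl R _).symm
      _ ≤ v h + u s := by
          refine add_le_add (Finset.sum_le_sum fun c _ => ?_) (Finset.sum_le_sum fun c _ => ?_)
          · exact mul_le_of_le_one_right (Finset.sum_nonneg fun d _ => hp.nonneg _ _ _)
              (hp.le_one _ _ _)
          · refine mul_le_of_le_one_left (hp.nonneg _ _ _) ?_
            rw [← hp.sum_eq_one h c]
            exact Finset.sum_le_univ_sum_of_nonneg fun d => hp.nonneg _ _ _
  have hu : ∀ (n : ℕ) (h : ℝ≥0), u (n * h) ≤ n * v h := fun n h => by
    induction n with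
    | zero =>
      have : u 0 = 0 := Finset.sum_eq_zero fun d hd => by
        have : d ≠ a := by
          rintro rfl
          simp [R, Relation.ReflTransGen.refl] at hd
        simp [hp.zero, this]
      simp [this]
    | succ n ih =>
      have := hstep h (n * h)
      rw [show h + n * h = ((n + 1 : ℕ) : ℝ≥0) * h by push_cast; ring] at this
      push_cast at this ⊢
      linarith
  have hb : p t b a ≤ u t := Finset.single_le_sum (f := fun d => p t d a)
    (fun d _ => hp.nonneg _ _ _) (by simpa [R] using hab)
  refine le_antisymm (hb.trans ?_) (hp.nonneg _ _ _)
  rcases (zero_le (a := t)).eq_or_lt with h0 | h0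
  · simpa [← h0] using hu 0 0
  have hlim : Tendsto (fun n : ℕ => t / ((n + 1 : ℕ) : ℝ≥0)) atTop (𝓝[>] 0) := by
    refine tendsto_nhdsWithin_iff.2 ⟨?_, Eventually.of_forall fun n => ?_⟩
    · exact (tendsto_const_div_atTop_nhds_zero_nat t).comp (tendsto_add_atTop_nat 1)
    · exact div_pos h0 (by positivity)
  refine ge_of_tendsto' (f := fun n : ℕ => (t : ℝ) * (v (t / ((n + 1 : ℕ) : ℝ≥0)) /
    (t / ((n + 1 : ℕ) : ℝ≥0) : ℝ≥0))) (by simpa using (hv.comp hlim).const_mul (t : ℝ)) fun n => ?_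
  have h1 := hu (n + 1) (t / ((n + 1 : ℕ) : ℝ≥0))
  rw [mul_div_cancel₀ _ (by positivity)] at h1
  refine h1.trans_eq ?_
  have : (t : ℝ) ≠ 0 := by exact_mod_cast h0.ne'
  push_cast
  field_simp

end Rates

/-! ### Sums over the jumps of a path -/

section Paths

variable {S : Type*} [TopologicalSpace S] [DiscreteTopology S] {w : ℝ≥0 → S}

/-- The sum of `f` over the first `N` steps of the path `w` sampled at mesh `h`. -/
noncomputable def stepSum (f : S → S → ℝ) (w : ℝ≥0 → S) (h : ℝ≥0) (N : ℕ) : ℝ :=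
  ∑ i ∈ Finset.range N, f (w (i * h)) (w ((i + 1) * h))

/-- By compactness, on all short enough intervals in `[0, T]` the path has at most one jump. -/
lemma IsJumpPath.exists_mesh (hw : IsJumpPath w) (T : ℝ≥0) :
    ∃ δ > 0, ∀ s ≤ T, ∃ τ, ∀ t, dist s t < δ →
      (t < τ → w t = Function.leftLim w τ) ∧ (τ ≤ t → w t = w τ) := by
  have hU : ∀ τ ∈ Icc 0 T,
      {t | (t < τ → w t = Function.leftLim w τ) ∧ (τ ≤ t → w t = w τ)} ∈ 𝓝 τ := fun τ _ => by
    have h1 := (hw τ).1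
    have h2 := tendsto_leftLim_of_tendsto (hw τ).2
    rw [ContinuousWithinAt, nhds_discrete, tendsto_pure, eventually_nhdsWithin_iff] at h1
    rw [nhds_discrete, tendsto_pure, eventually_nhdsWithin_iff] at h2
    exact h2.and h1
  obtain ⟨V, hV, h⟩ := lebesgue_number_lemma_nhds isCompact_Icc hU
  obtain ⟨δ, hδ, hδV⟩ := Metric.mem_uniformity_dist.1 hV
  refine ⟨δ, hδ, fun s hs => ?_⟩
  obtain ⟨τ, hτ⟩ := h s ⟨zero_le, hs⟩
  exact ⟨τ, fun t ht => hτ (hδV ht)⟩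

lemma leftLim_eq_of_eqOn {s t : ℝ≥0} (hst : s < t) {a : S} (h : ∀ u ∈ Ioo s t, w u = a) :
    Function.leftLim w t = a := by
  have : (𝓝[<] t).NeBot := nhdsLT_neBot_of_exists_lt ⟨s, hst⟩
  refine leftLim_eq_of_tendsto (tendsto_nhds_of_eventually_eq ?_)
  filter_upwards [Ioo_mem_nhdsLT hst] with u hu using h u hu

/-- If `w` can only jump at `τ` within `[s, s']`, the net change from `s` to `s'` is the jump. -/
lemma finsum_jumps_Ioc (f : S → S → ℝ) (hf : ∀ a, f a a = 0) {s s' τ : ℝ≥0} (hs : s ≤ s')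
    (h : ∀ t ∈ Icc s s', (t < τ → w t = Function.leftLim w τ) ∧ (τ ≤ t → w t = w τ)) :
    {t | t ∈ Ioc s s' ∧ w t ≠ Function.leftLim w t}.Finite ∧
      ∑ᶠ t ∈ {t | t ∈ Ioc s s' ∧ w t ≠ Function.leftLim w t}, f (Function.leftLim w t) (w t) =
        f (w s) (w s') := by
  set J := {t | t ∈ Ioc s s' ∧ w t ≠ Function.leftLim w t}
  have hJ : J ⊆ {τ} := by
    rintro t ⟨⟨h1, h2⟩, h3⟩
    by_contra hne
    apply h3
    rcases lt_or_gt_of_ne (show t ≠ τ from hne) with hlt | hlt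
    · refine (leftLim_eq_of_eqOn h1 fun u hu => ?_).symm
      rw [(h t ⟨h1.le, h2⟩).1 hlt, (h u ⟨hu.1.le, hu.2.le.trans h2⟩).1 (hu.2.trans hlt)]
    · refine (leftLim_eq_of_eqOn (max_lt h1 hlt) fun u hu => ?_).symm
      obtain ⟨hu1, hu2⟩ := max_lt_iff.1 hu.1
      rw [(h t ⟨h1.le, h2⟩).2 hlt.le, (h u ⟨hu1.le, hu.2.le.trans h2⟩).2 hu2.le]
  refine ⟨(finite_singleton τ).subset hJ, ?_⟩
  have hs1 := h s ⟨le_rfl, hs⟩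
  have hs2 := h s' ⟨hs, le_rfl⟩
  by_cases hτ : τ ∈ J
  · rw [hJ.antisymm (singleton_subset_iff.2 hτ), finsum_mem_singleton, hs1.1 hτ.1.1, hs2.2 hτ.1.2]
  · have hempty : J = ∅ := eq_empty_of_forall_notMem fun t ht => hτ (hJ ht ▸ ht)
    rw [hempty, finsum_mem_empty]
    suffices w s = w s' by rw [this, hf]
    rcases le_or_gt τ s with h1 | h1
    · rw [hs1.2 h1, hs2.2 (h1.trans hs)]
    · rcases lt_or_ge s' τ with h2 | h2
      · rw [hs1.1 h1, hs2.1 h2]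
      · have : w τ = Function.leftLim w τ := by_contra fun h3 => hτ ⟨⟨h1, h2⟩, h3⟩
        rw [hs1.1 h1, hs2.2 h2, this]

/-- Below a mesh depending on the path, sampling the path sees exactly its jumps. -/
lemma IsJumpPath.exists_finsum_jumpTimes_eq (hw : IsJumpPath w) (f : S → S → ℝ)
    (hf : ∀ a, f a a = 0) (T : ℝ≥0) : ∃ δ > 0, ∀ h : ℝ≥0, h < δ → ∀ N : ℕ, N * h ≤ T →
      (jumpTimes w (N * h)).Finite ∧
        ∑ᶠ t ∈ jumpTimes w (N * h), f (Function.leftLim w t) (w t) = stepSum f w h N := by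
  obtain ⟨δ, hδ, hmesh⟩ := hw.exists_mesh T
  refine ⟨δ.toNNReal, Real.toNNReal_pos.2 hδ, fun h hh N => ?_⟩
  induction N with
  | zero => simp [jumpTimes, stepSum]
  | succ N ih =>
    intro hN
    push_cast at hN ⊢
    have hle : N * h ≤ (N + 1) * h := by gcongr; exact le_self_add
    obtain ⟨ih1, ih2⟩ := ih (hle.trans hN)
    obtain ⟨τ, hτ⟩ := hmesh (N * h) (hle.trans hN)
    obtain ⟨h1, h2⟩ := finsum_jumps_Ioc f hf hle (τ := τ) fun t ht => hτ t (by
      rw [dist_comm, NNReal.dist_eq, abs_of_nonneg (sub_nonneg.2 (by exact_mod_cast ht.1))]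
      have h3 : (t : ℝ) ≤ (N + 1) * h := by exact_mod_cast ht.2
      have h4 : (h : ℝ) < δ := Real.lt_toNNReal_iff_coe_lt.1 hh
      push_cast
      linarith)
    have hunion : jumpTimes w ((N + 1) * h) = jumpTimes w (N * h) ∪
        {t | t ∈ Ioc (N * h) ((N + 1) * h) ∧ w t ≠ Function.leftLim w t} := by
      rw [jumpTimes, ← Ioc_union_Ioc_eq_Ioc (zero_le (a := N * h)) hle]
      ext t
      simp only [jumpTimes, mem_union, mem_ofPred_eq]
      tauto
    have hdisj : Disjoint (jumpTimes w (N * h))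
        {t | t ∈ Ioc (N * h) ((N + 1) * h) ∧ w t ≠ Function.leftLim w t} :=
      Set.disjoint_left.2 fun t ht ht' => ht'.1.1.not_ge ht.1.2
    rw [hunion]
    refine ⟨ih1.union h1, ?_⟩
    rw [finsum_mem_union hdisj ih1 h1, ih2, h2, stepSum, stepSum, Finset.sum_range_succ]

/-- The dyadic mesh of order `n` on `[0, T]`. -/
noncomputable def dyadicMesh (T : ℝ≥0) (n : ℕ) : ℝ≥0 := T / 2 ^ n

lemma two_pow_mul_dyadicMesh (T : ℝ≥0) (n : ℕ) : ((2 ^ n : ℕ) : ℝ≥0) * dyadicMesh T n = T := by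
  rw [dyadicMesh]; push_cast; field_simp

lemma tendsto_dyadicMesh (T : ℝ≥0) : Tendsto (dyadicMesh T) atTop (𝓝 0) := by
  have : Tendsto (fun n : ℕ => T * (1 / 2) ^ n) atTop (𝓝 (T * 0)) :=
    (NNReal.tendsto_pow_atTop_nhds_zero_of_lt_one (by norm_num : (1 / 2 : ℝ≥0) < 1)).const_mul T
  simp only [one_div, inv_pow, mul_zero, ← div_eq_mul_inv] at this
  exact this

lemma IsJumpPath.eventually_stepSum_eq (hw : IsJumpPath w) (f : S → S → ℝ)
    (hf : ∀ a, f a a = 0) (T : ℝ≥0) : ∀ᶠ n in atTop, stepSum f w (dyadicMesh T n) (2 ^ n) =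
      ∑ᶠ t ∈ jumpTimes w T, f (Function.leftLim w t) (w t) := by
  obtain ⟨δ, hδ, h⟩ := hw.exists_finsum_jumpTimes_eq f hf T
  filter_upwards [(tendsto_dyadicMesh T).eventually_lt_const hδ] with n hn
  have := (h _ hn (2 ^ n) (two_pow_mul_dyadicMesh T n).le).2
  rw [two_pow_mul_dyadicMesh] at this
  exact this.symm

end Paths

/-- Refining a dyadic mesh can only reveal more changes of configuration. -/
lemma monotone_stepSum_dyadicMesh {S : Type*} [DecidableEq S] (w : ℝ≥0 → S) (T : ℝ≥0) :
    Monotone fun n => stepSum (fun a b => if b = a then 0 else 1) w (dyadicMesh T n) (2 ^ n) := by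
  have hsplit : ∀ (g : ℕ → ℝ) (m : ℕ), ∑ i ∈ Finset.range (2 * m), g i =
      ∑ i ∈ Finset.range m, (g (2 * i) + g (2 * i + 1)) := fun g m => by
    induction m with
    | zero => simp
    | succ m ih => rw [Nat.mul_succ, Finset.sum_range_succ, Finset.sum_range_succ, ih,
        Finset.sum_range_succ, add_assoc]
  refine monotone_nat_of_le_succ fun n => ?_
  have hm : dyadicMesh T n = 2 * dyadicMesh T (n + 1) := by
    rw [dyadicMesh, dyadicMesh, pow_succ]; field_simp
  simp only [stepSum]
  rw [pow_succ' 2 n, hsplit, hm]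
  refine Finset.sum_le_sum fun i _ => ?_
  generalize dyadicMesh T (n + 1) = h
  rw [show (i : ℝ≥0) * (2 * h) = ((2 * i : ℕ) : ℝ≥0) * h by push_cast; ring,
    show ((i : ℝ≥0) + 1) * (2 * h) = (((2 * i + 1 : ℕ) : ℝ≥0) + 1) * h by push_cast; ring,
    show (((2 * i : ℕ) : ℝ≥0) + 1) * h = ((2 * i + 1 : ℕ) : ℝ≥0) * h by push_cast; ring]
  generalize w (((2 * i : ℕ) : ℝ≥0) * h) = a
  generalize w (((2 * i + 1 : ℕ) : ℝ≥0) * h) = b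
  generalize w ((((2 * i + 1 : ℕ) : ℝ≥0) + 1) * h) = c
  by_cases h1 : b = a
  · simp [h1]
  · simp only [h1, if_false]
    split_ifs <;> norm_num

/-! ### Expectations of sampled sums -/

section Expectation

variable {S : Type*} [Fintype S] {p : ℝ≥0 → S → S → ℝ}

/-- The left Riemann sum, on the dyadic mesh of order `n`, of `∫₀ᵀ 𝔼[g(ω_t) | ω_0 = a] dt`. -/
noncomputable def occupationSum (p : ℝ≥0 → S → S → ℝ) (a : S) (T : ℝ≥0) (g : S → ℝ) (n : ℕ) : ℝ :=
  ∑ i ∈ Finset.range (2 ^ n), dyadicMesh T n * ∑ b, p (i * dyadicMesh T n) b a * g b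

lemma occupationSum_nonneg [DecidableEq S] (hp : IsTransitionFunction p) (a : S) (T : ℝ≥0)
    {g : S → ℝ} (hg : ∀ b, 0 ≤ g b) (n : ℕ) : 0 ≤ occupationSum p a T g n :=
  Finset.sum_nonneg fun _ _ => mul_nonneg (NNReal.coe_nonneg _)
    (Finset.sum_nonneg fun _ _ => mul_nonneg (hp.nonneg _ _ _) (hg _))

lemma occupationSum_const_sub [DecidableEq S] (hp : IsTransitionFunction p) (a : S) (T : ℝ≥0)
    (c k : ℝ) (g : S → ℝ) (n : ℕ) :
    occupationSum p a T (fun b => c - k * g b) n = T * c - k * occupationSum p a T g n := by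
  have h1 : ∀ t, ∑ b, p t b a * (c - k * g b) = c - k * ∑ b, p t b a * g b := fun t => by
    simp_rw [mul_sub, Finset.sum_sub_distrib, ← Finset.sum_mul, hp.sum_eq_one, one_mul,
      Finset.mul_sum]
    congr 1
    exact Finset.sum_congr rfl fun b _ => by ring
  have h2 : ((2 ^ n : ℕ) : ℝ) * dyadicMesh T n = T := by
    exact_mod_cast congrArg ((↑) : ℝ≥0 → ℝ) (two_pow_mul_dyadicMesh T n)
  simp_rw [occupationSum, h1, mul_sub, Finset.sum_sub_distrib, Finset.sum_const,
    Finset.card_range, nsmul_eq_mul, ← mul_assoc, h2, Finset.mul_sum]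
  congr 1
  exact Finset.sum_congr rfl fun i _ => Finset.sum_congr rfl fun b _ => by ring

lemma occupationSum_eq_zero (a : S) (T : ℝ≥0) {g : S → ℝ} (n : ℕ)
    (h : ∀ t b, p t b a * g b = 0) : occupationSum p a T g n = 0 := by
  simp [occupationSum, h]

/-- An accessible `b` keeps a positive probability throughout `[T / 2, T]`, so its occupation sums
stay away from zero. -/
lemma exists_le_occupationSum [DecidableEq S] {G : Hilb S →L[ℝ] Hilb S}
    (hp : IsTransitionFunction p) (hG : IsGenerator p G) {a b : S}
    (hab : Relation.ReflTransGen (CanJump G) a b) {T : ℝ≥0} (hT : 0 < T) {g : S → ℝ}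
    (hg : ∀ c, 0 ≤ g c) (hb : 0 < g b) : ∃ ε > 0, ∀ n, ε ≤ occupationSum p a T g (n + 1) := by
  obtain ⟨δ, hδ, h1⟩ := hp.exists_forall_le_self hG T b
  have h2 := hp.pos_of_reflTransGen hG hab (half_pos hT)
  refine ⟨T / 2 * (δ * p (T / 2) b a * g b),
    mul_pos (by exact_mod_cast half_pos hT) (by positivity), fun n => ?_⟩
  have hmesh := two_pow_mul_dyadicMesh T (n + 1)
  set h := dyadicMesh T (n + 1)
  have hhalf : ((2 ^ n : ℕ) : ℝ≥0) * h = T / 2 := by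
    rw [← hmesh]; push_cast; rw [pow_succ]; field_simp
  have hterm : ∀ i ∈ Finset.Ico (2 ^ n) (2 ^ (n + 1) : ℕ),
      h * (δ * p (T / 2) b a * g b) ≤ h * ∑ c, p (i * h) c a * g c := fun i hi => by
    obtain ⟨hi1, hi2⟩ := Finset.mem_Ico.1 hi
    have hle : T / 2 ≤ i * h := by
      rw [← hhalf]; gcongr
    have hle' : i * h ≤ T := by
      rw [← hmesh]; gcongr
    have h3 := hp.mul_le_add (i * h - T / 2) (T / 2) b b a
    rw [tsub_add_cancel_of_le hle] at h3
    have h4 := h1 (i * h - T / 2) (tsub_le_self.trans hle')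
    refine mul_le_mul_of_nonneg_left ?_ h.2
    refine le_trans ?_ (Finset.single_le_sum (f := fun c => p (i * h) c a * g c)
      (fun c _ => mul_nonneg (hp.nonneg _ _ _) (hg c)) (Finset.mem_univ b))
    exact mul_le_mul_of_nonneg_right ((mul_le_mul_of_nonneg_right h4 h2.le).trans h3) hb.le
  calc (T : ℝ) / 2 * (δ * p (T / 2) b a * g b)
      = ∑ i ∈ Finset.Ico (2 ^ n) (2 ^ (n + 1) : ℕ), h * (δ * p (T / 2) b a * g b) := by
        have h5 : ((2 ^ n : ℕ) : ℝ) * h = T / 2 := by exact_mod_cast congrArg ((↑) : ℝ≥0 → ℝ) hhalf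
        rw [Finset.sum_const, Nat.card_Ico, nsmul_eq_mul, ← h5, pow_succ, mul_two,
          Nat.add_sub_cancel, mul_assoc]
    _ ≤ ∑ i ∈ Finset.Ico (2 ^ n) (2 ^ (n + 1) : ℕ), h * ∑ c, p (i * h) c a * g c :=
        Finset.sum_le_sum hterm
    _ ≤ occupationSum p a T g (n + 1) :=
        Finset.sum_le_sum_of_subset_of_nonneg
          (fun i hi => Finset.mem_range.2 (Finset.mem_Ico.1 hi).2)
          fun _ _ _ => mul_nonneg h.2
            (Finset.sum_nonneg fun _ _ => mul_nonneg (hp.nonneg _ _ _) (hg _))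

variable [TopologicalSpace S] [MeasurableSpace S] [MeasurableSingletonClass S]
  {E : Type*} [MeasurableSpace E] {μ : Measure E} {X : ℝ≥0 → E → S}

lemma IsMarkovJumpProcess.measurableSet_eq (hX : IsMarkovJumpProcess p X μ) (t : ℝ≥0) (a : S) :
    MeasurableSet {x | X t x = a} :=
  hX.measurable t (measurableSet_singleton a)

variable [IsProbabilityMeasure μ]

lemma IsMarkovJumpProcess.cond_real_pair (hX : IsMarkovJumpProcess p X μ) {ω : S}
    (hω : μ {x | X 0 x = ω} ≠ 0) (s h : ℝ≥0) (a b : S) :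
    (ProbabilityTheory.cond μ {x | X 0 x = ω}).real {x | X s x = a ∧ X (s + h) x = b} =
      p s a ω * p h b a := by
  have hm := hX.markov 2 ![0, s, s + h] ![ω, a, b] (by
    refine Fin.monotone_iff_le_succ.2 fun i => ?_
    fin_cases i <;> simp)
  have hset : {x | ∀ i : Fin 3, X ((![0, s, s + h] : Fin 3 → ℝ≥0) i) x =
      (![ω, a, b] : Fin 3 → S) i} = {x | X 0 x = ω} ∩ {x | X s x = a ∧ X (s + h) x = b} := by
    ext x
    simp [Fin.forall_fin_succ]
  rw [hset] at hm
  simp only [Fin.prod_univ_two] at hm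
  have hr : μ.real {x | X 0 x = ω} ≠ 0 := (measureReal_ne_zero_iff).2 hω
  rw [measureReal_def, cond_apply (hX.measurableSet_eq 0 ω), ENNReal.toReal_mul,
    ENNReal.toReal_inv, ← measureReal_def, ← measureReal_def, hm]
  simp [hr]

lemma IsMarkovJumpProcess.integrable_and_integral_pair (hX : IsMarkovJumpProcess p X μ) {ω : S}
    (hω : μ {x | X 0 x = ω} ≠ 0) (f : S → S → ℝ) (s h : ℝ≥0) :
    Integrable (fun x => f (X s x) (X (s + h) x)) (ProbabilityTheory.cond μ {x | X 0 x = ω}) ∧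
    ∫ x, f (X s x) (X (s + h) x) ∂(ProbabilityTheory.cond μ {x | X 0 x = ω}) =
      ∑ a, p s a ω * ∑ b, f a b * p h b a := by
  classical
  have : IsProbabilityMeasure (ProbabilityTheory.cond μ {x | X 0 x = ω}) :=
    cond_isProbabilityMeasure hω
  have hms : ∀ a b, MeasurableSet {x | X s x = a ∧ X (s + h) x = b} := fun a b =>
    (hX.measurableSet_eq s a).inter (hX.measurableSet_eq (s + h) b)
  have hdecomp : (fun x => f (X s x) (X (s + h) x)) = fun x => ∑ a, ∑ b,
      {x | X s x = a ∧ X (s + h) x = b}.indicator (fun _ => f a b) x := by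
    ext x
    rw [Finset.sum_eq_single (X s x), Finset.sum_eq_single (X (s + h) x)] <;>
      simp +contextual [Set.indicator, eq_comm]
  have hint : ∀ a b, Integrable ({x | X s x = a ∧ X (s + h) x = b}.indicator fun _ => f a b)
      (ProbabilityTheory.cond μ {x | X 0 x = ω}) := fun a b =>
    (integrable_const _).indicator (hms a b)
  rw [hdecomp]
  refine ⟨integrable_finsetSum _ fun a _ => integrable_finsetSum _ fun b _ => hint a b, ?_⟩
  rw [integral_finsetSum _ fun a _ => integrable_finsetSum _ fun b _ => hint a b]
  refine Finset.sum_congr rfl fun a _ => ?_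
  rw [integral_finsetSum _ fun b _ => hint a b, Finset.mul_sum]
  refine Finset.sum_congr rfl fun b _ => ?_
  rw [integral_indicator_const _ (hms a b), hX.cond_real_pair hω, smul_eq_mul]
  ring

lemma IsMarkovJumpProcess.integrable_stepSum (hX : IsMarkovJumpProcess p X μ) {ω : S}
    (hω : μ {x | X 0 x = ω} ≠ 0) (f : S → S → ℝ) (h : ℝ≥0) (N : ℕ) :
    Integrable (fun x => stepSum f (fun t => X t x) h N)
      (ProbabilityTheory.cond μ {x | X 0 x = ω}) := by
  simp only [stepSum, add_one_mul]
  exact integrable_finsetSum _ fun i _ => (hX.integrable_and_integral_pair hω f _ _).1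

lemma IsMarkovJumpProcess.integral_stepSum (hX : IsMarkovJumpProcess p X μ) {ω : S}
    (hω : μ {x | X 0 x = ω} ≠ 0) (f : S → S → ℝ) (h : ℝ≥0) (N : ℕ) :
    ∫ x, stepSum f (fun t => X t x) h N ∂(ProbabilityTheory.cond μ {x | X 0 x = ω}) =
      ∑ i ∈ Finset.range N, ∑ a, p (i * h) a ω * ∑ b, f a b * p h b a := by
  simp only [stepSum, add_one_mul]
  rw [integral_finsetSum _ fun i _ => (hX.integrable_and_integral_pair hω f _ _).1]
  exact Finset.sum_congr rfl fun i _ => (hX.integrable_and_integral_pair hω f _ _).2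

/-- As the mesh shrinks, one step from `a` contributes `h * ∑ b, f a b * G^b_a + o(h)` on average,
and the `2 ^ n` error terms add up to `o(1)`. -/
lemma IsMarkovJumpProcess.tendsto_integral_stepSum_sub [DecidableEq S]
    {G : Hilb S →L[ℝ] Hilb S} (hp : IsTransitionFunction p) (hG : IsGenerator p G)
    (hX : IsMarkovJumpProcess p X μ) {ω : S}
    (hω : μ {x | X 0 x = ω} ≠ 0) (f : S → S → ℝ) (hf : ∀ a, f a a = 0) (T : ℝ≥0) :
    Tendsto (fun n =>
      ∫ x, stepSum f (fun t => X t x) (dyadicMesh T n) (2 ^ n)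
        ∂(ProbabilityTheory.cond μ {x | X 0 x = ω}) -
      occupationSum p ω T (fun a => ∑ b, f a b * elem G b a) n) atTop (𝓝 0) := by
  let e : ℝ≥0 → S → ℝ := fun h a => ∑ b, f a b * p h b a - h * ∑ b, f a b * elem G b a
  have hbound : ∀ n, |∫ x, stepSum f (fun t => X t x) (dyadicMesh T n) (2 ^ n)
        ∂(ProbabilityTheory.cond μ {x | X 0 x = ω}) -
      occupationSum p ω T (fun a => ∑ b, f a b * elem G b a) n| ≤
      (2 ^ n : ℕ) * ∑ a, |e (dyadicMesh T n) a| := fun n => by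
    have : ∫ x, stepSum f (fun t => X t x) (dyadicMesh T n) (2 ^ n)
        ∂(ProbabilityTheory.cond μ {x | X 0 x = ω}) -
        occupationSum p ω T (fun a => ∑ b, f a b * elem G b a) n =
        ∑ i ∈ Finset.range (2 ^ n), ∑ a, p (i * dyadicMesh T n) a ω * e (dyadicMesh T n) a := by
      rw [hX.integral_stepSum hω, occupationSum, ← Finset.sum_sub_distrib]
      refine Finset.sum_congr rfl fun i _ => ?_
      rw [Finset.mul_sum, ← Finset.sum_sub_distrib]
      exact Finset.sum_congr rfl fun a _ => by simp only [e]; ring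
    rw [this]
    refine (Finset.abs_sum_le_sum_abs _ _).trans ?_
    refine (Finset.sum_le_card_nsmul _ _ (∑ a, |e (dyadicMesh T n) a|) fun i _ => ?_).trans_eq
      (by rw [Finset.card_range, nsmul_eq_mul])
    refine (Finset.abs_sum_le_sum_abs _ _).trans (Finset.sum_le_sum fun a _ => ?_)
    rw [abs_mul, abs_of_nonneg (hp.nonneg _ _ _)]
    exact mul_le_of_le_one_left (abs_nonneg _) (hp.le_one _ _ _)
  refine squeeze_zero_norm hbound ?_
  rcases (zero_le (a := T)).eq_or_lt with rfl | hT
  · have he : ∀ a, e 0 a = 0 := fun a => by simp [e, hp.zero, hf]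
    simp [dyadicMesh, he]
  have hmesh : Tendsto (dyadicMesh T) atTop (𝓝[>] 0) :=
    tendsto_nhdsWithin_iff.2 ⟨tendsto_dyadicMesh T,
      Eventually.of_forall fun n => div_pos hT (by positivity)⟩
  have he : ∀ a, Tendsto (fun h : ℝ≥0 => e h a / h) (𝓝[>] 0) (𝓝 0) := fun a => by
    have h1 : Tendsto (fun h : ℝ≥0 => ∑ b, f a b * (p h b a / h) - ∑ b, f a b * elem G b a)
        (𝓝[>] 0) (𝓝 0) := by
      rw [← sub_self (∑ b, f a b * elem G b a)]
      refine (tendsto_finsetSum _ fun b _ => ?_).sub_const _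
      by_cases hb : b = a
      · simp [hb, hf]
      · exact (hG.tendsto_of_ne hb).const_mul _
    refine h1.congr' ?_
    filter_upwards [self_mem_nhdsWithin] with h hh
    have : (h : ℝ) ≠ 0 := by exact_mod_cast (ne_of_gt hh)
    simp only [e]
    rw [sub_div, mul_div_cancel_left₀ _ this, Finset.sum_div]
    simp_rw [mul_div_assoc]
  have hlim : Tendsto (fun n => (T : ℝ) * ∑ a, |e (dyadicMesh T n) a / dyadicMesh T n|) atTop
      (𝓝 (T * ∑ _a : S, |(0 : ℝ)|)) :=
    (tendsto_finsetSum _ fun a _ => ((he a).comp hmesh).abs).const_mul _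
  rw [abs_zero, Finset.sum_const_zero, mul_zero] at hlim
  refine hlim.congr fun n => ?_
  have hpos : (0 : ℝ) < dyadicMesh T n := NNReal.coe_pos.2 (div_pos hT (by positivity))
  have hT' : ((2 ^ n : ℕ) : ℝ) * dyadicMesh T n = T := by
    exact_mod_cast congrArg ((↑) : ℝ≥0 → ℝ) (two_pow_mul_dyadicMesh T n)
  rw [← hT']
  simp_rw [abs_div, abs_of_pos hpos, ← Finset.sum_div]
  field_simp

end Expectation

/-! ### The expected Lagrangian -/

lemma integrable_of_tendsto_of_tendsto_integral {α : Type*} [MeasurableSpace α] {ν : Measure α}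
    {D : ℕ → α → ℝ} {N : α → ℝ} {C : ℝ} (hD : ∀ n, Integrable (D n) ν)
    (hnonneg : ∀ n x, 0 ≤ D n x) (hlim : ∀ᵐ x ∂ν, Tendsto (fun n => D n x) atTop (𝓝 (N x)))
    (hint : Tendsto (fun n => ∫ x, D n x ∂ν) atTop (𝓝 C)) : Integrable N ν := by
  refine ⟨aestronglyMeasurable_of_tendsto_ae _ (fun n => (hD n).1) hlim, ?_⟩
  have h1 : ∀ n, ∫⁻ x, ‖D n x‖ₑ ∂ν = ENNReal.ofReal (∫ x, D n x ∂ν) := fun n => by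
    rw [← ofReal_integral_norm_eq_lintegral_enorm (hD n)]
    simp_rw [Real.norm_eq_abs, abs_of_nonneg (hnonneg n _)]
  calc ∫⁻ x, ‖N x‖ₑ ∂ν = ∫⁻ x, liminf (fun n => ‖D n x‖ₑ) atTop ∂ν :=
        lintegral_congr_ae (by filter_upwards [hlim] with x hx using hx.enorm.liminf_eq.symm)
    _ ≤ liminf (fun n => ∫⁻ x, ‖D n x‖ₑ ∂ν) atTop :=
        lintegral_liminf_le' fun n => (hD n).1.aemeasurable.enorm
    _ = ENNReal.ofReal C := by
        simp_rw [h1]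
        exact (ENNReal.tendsto_ofReal hint).liminf_eq
    _ < ⊤ := ENNReal.ofReal_lt_top

lemma lagrangianIntegral_eq {S : Type*} [Fintype S] [DecidableEq S] [TopologicalSpace S]
    {p : ℝ≥0 → S → S → ℝ} {G : Hilb S →L[ℝ] Hilb S} {K : ℝ}
    (hp : IsTransitionFunction p) (hG : IsGenerator p G)
    (hGK : ∀ a, |elem G a a| = K) (T : ℝ≥0) (w : ℝ≥0 → S) :
    lagrangianIntegral G T w =
      K * T - ∑ᶠ t ∈ jumpTimes w T, jumpCost G (Function.leftLim w t) (w t) := by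
  rw [lagrangianIntegral]
  congr 1
  · simp [hG.elem_self hp hGK, mul_comm]
  · exact finsum_mem_congr rfl fun t ht => by rw [jumpCost, if_neg ht.2]

section Dynamics

variable {S : Type*} [Fintype S] [DecidableEq S] [TopologicalSpace S] [DiscreteTopology S]
  [MeasurableSpace S] [MeasurableSingletonClass S]
  {p : ℝ≥0 → S → S → ℝ} {G : Hilb S →L[ℝ] Hilb S} {K : ℝ}
  {E : Type*} [MeasurableSpace E] {μ : Measure E} [IsProbabilityMeasure μ] {X : ℝ≥0 → E → S}

/-- The number of changes of configuration seen on a mesh bounds, up to a constant, every sampled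
sum; it increases to the number of jumps, whose mean is finite because the limit of the means of
the sampled counts is `K * T`. -/
lemma IsMarkovJumpProcess.tendsto_integral_stepSum (hp : IsTransitionFunction p)
    (hG : IsGenerator p G) (hGK : ∀ a, |elem G a a| = K)
    (hX : IsMarkovJumpProcess p X μ) {ω : S} (hω : μ {x | X 0 x = ω} ≠ 0) (f : S → S → ℝ)
    (hf : ∀ a, f a a = 0) (T : ℝ≥0) :
    Integrable (fun x => ∑ᶠ t ∈ jumpTimes (fun t => X t x) T,
      f (Function.leftLim (fun t => X t x) t) (X t x))
      (ProbabilityTheory.cond μ {x | X 0 x = ω}) ∧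
    Tendsto (fun n => ∫ x, stepSum f (fun t => X t x) (dyadicMesh T n) (2 ^ n)
      ∂(ProbabilityTheory.cond μ {x | X 0 x = ω})) atTop
      (𝓝 (∫ x, ∑ᶠ t ∈ jumpTimes (fun t => X t x) T,
        f (Function.leftLim (fun t => X t x) t) (X t x)
        ∂(ProbabilityTheory.cond μ {x | X 0 x = ω}))) := by
  set ν := ProbabilityTheory.cond μ {x | X 0 x = ω}
  have hpaths : ∀ᵐ x ∂ν, IsJumpPath fun t => X t x :=
    cond_absolutelyContinuous.ae_le hX.paths
  let F : (S → S → ℝ) → ℕ → E → ℝ :=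
    fun g n x => stepSum g (fun t => X t x) (dyadicMesh T n) (2 ^ n)
  let J : (S → S → ℝ) → E → ℝ := fun g x => ∑ᶠ t ∈ jumpTimes (fun t => X t x) T,
    g (Function.leftLim (fun t => X t x) t) (X t x)
  have hlim : ∀ g : S → S → ℝ, (∀ a, g a a = 0) →
      ∀ᵐ x ∂ν, Tendsto (fun n => F g n x) atTop (𝓝 (J g x)) := fun g hg => by
    filter_upwards [hpaths] with x hx
    exact tendsto_nhds_of_eventually_eq (hx.eventually_stepSum_eq g hg T)
  have hint : ∀ g n, Integrable (F g n) ν := fun g n => hX.integrable_stepSum hω g _ _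
  -- summing `d` counts changes of configuration, which occur at the same rate `K` everywhere
  let d : S → S → ℝ := fun a b => if b = a then 0 else 1
  have hd : ∀ a, d a a = 0 := fun a => by simp [d]
  have hrate : ∀ a, ∑ b, d a b * elem G b a = K := fun a => by
    rw [← Finset.add_sum_erase _ _ (Finset.mem_univ a), hd, zero_mul, zero_add,
      ← hG.sum_erase hp hGK a]
    exact Finset.sum_congr rfl fun b hb => by simp [d, Finset.ne_of_mem_erase hb]
  have hmean : Tendsto (fun n => ∫ x, F d n x ∂ν) atTop (𝓝 (T * K)) := by
    have h := hX.tendsto_integral_stepSum_sub hp hG hω d hd T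
    have hocc : ∀ n, occupationSum p ω T (fun _ => K) n = T * K := fun n => by
      simpa using occupationSum_const_sub hp ω T K 0 (fun _ => 0) n
    simp_rw [hrate, hocc] at h
    simpa using h.add_const ((T : ℝ) * K)
  have hN : Integrable (J d) ν := integrable_of_tendsto_of_tendsto_integral (hint d)
    (fun n x => Finset.sum_nonneg fun i _ => by simp only [d]; split_ifs <;> norm_num)
    (hlim d hd) hmean
  let C : ℝ := ∑ a, ∑ b, |f a b|
  have hC : ∀ a b, |f a b| ≤ C * d a b := fun a b => by
    by_cases hab : b = a
    · simp [hab, hf, hd]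
    · rw [show d a b = 1 by simp [d, hab], mul_one]
      exact (Finset.single_le_sum (f := fun b => |f a b|) (fun _ _ => abs_nonneg _)
        (Finset.mem_univ b)).trans (Finset.single_le_sum (f := fun a => ∑ b, |f a b|)
        (fun _ _ => Finset.sum_nonneg fun _ _ => abs_nonneg _) (Finset.mem_univ a))
  have hC0 : 0 ≤ C := Finset.sum_nonneg fun _ _ => Finset.sum_nonneg fun _ _ => abs_nonneg _
  have hdom : ∀ n, ∀ᵐ x ∂ν, ‖F f n x‖ ≤ C * J d x := fun n => by
    filter_upwards [hlim d hd] with x hx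
    have h1 : F d n x ≤ J d x :=
      (monotone_stepSum_dyadicMesh (fun t => X t x) T).ge_of_tendsto hx n
    refine le_trans ?_ (mul_le_mul_of_nonneg_left h1 hC0)
    rw [Real.norm_eq_abs]
    refine (Finset.abs_sum_le_sum_abs _ _).trans ?_
    simp only [F, stepSum, Finset.mul_sum]
    exact Finset.sum_le_sum fun i _ => hC _ _
  have hb : Integrable (fun x => C * J d x) ν := hN.const_mul C
  exact ⟨⟨aestronglyMeasurable_of_tendsto_ae _ (fun n => (hint f n).1) (hlim f hf),
      hasFiniteIntegral_of_dominated_convergence hb.2 hdom (hlim f hf)⟩,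
    tendsto_integral_of_dominated_convergence _ (fun n => (hint f n).1) hb hdom (hlim f hf)⟩

lemma IsMarkovJumpProcess.integrable_lagrangianIntegral (hp : IsTransitionFunction p)
    (hG : IsGenerator p G) (hGK : ∀ a, |elem G a a| = K)
    (hX : IsMarkovJumpProcess p X μ) {ω : S} (hω : μ {x | X 0 x = ω} ≠ 0) (T : ℝ≥0) :
    Integrable (fun x => lagrangianIntegral G T fun t => X t x)
      (ProbabilityTheory.cond μ {x | X 0 x = ω}) := by
  have := cond_isProbabilityMeasure hω
  simp_rw [lagrangianIntegral_eq hp hG hGK]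
  exact (integrable_const _).sub
    (hX.tendsto_integral_stepSum hp hG hGK hω (jumpCost G) (jumpCost_self G) T).1

/-- The excess of the expected Lagrangian over `K * T * (1 - log K)` is `K` times the integral
over `[0, T]` of the expected entropy, here in the form of a limit of Riemann sums. -/
lemma IsMarkovJumpProcess.tendsto_occupationSum_jumpEntropy (hp : IsTransitionFunction p)
    (hG : IsGenerator p G) (hK : 0 < K) (hGK : ∀ a, |elem G a a| = K)
    (hX : IsMarkovJumpProcess p X μ) {ω : S} (hω : μ {x | X 0 x = ω} ≠ 0) (T : ℝ≥0) :
    Tendsto (fun n => K * occupationSum p ω T (jumpEntropy G K) n) atTop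
      (𝓝 (expectedLagrangian G X μ T ω - K * T * (1 - Real.log K))) := by
  have := cond_isProbabilityMeasure hω
  obtain ⟨h1, h2⟩ := hX.tendsto_integral_stepSum hp hG hGK hω (jumpCost G) (jumpCost_self G) T
  have h3 := hX.tendsto_integral_stepSum_sub hp hG hω (jumpCost G) (jumpCost_self G) T
  simp_rw [sum_jumpCost_mul_elem hp hG hK hGK, occupationSum_const_sub hp] at h3
  have h4 : expectedLagrangian G X μ T ω = K * T - ∫ x, ∑ᶠ t ∈ jumpTimes (fun t => X t x) T,
      jumpCost G (Function.leftLim (fun t => X t x) t) (X t x)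
      ∂(ProbabilityTheory.cond μ {x | X 0 x = ω}) := by
    simp_rw [expectedLagrangian, lagrangianIntegral_eq hp hG hGK]
    rw [integral_sub (integrable_const _) h1, integral_const]
    simp
  rw [h4]
  convert (h3.sub h2).add_const (T * (K * Real.log K)) using 2 <;> ring

lemma IsMarkovJumpProcess.le_expectedLagrangian (hp : IsTransitionFunction p)
    (hG : IsGenerator p G) (hK : 0 < K) (hGK : ∀ a, |elem G a a| = K)
    (hX : IsMarkovJumpProcess p X μ) {ω : S} (hω : μ {x | X 0 x = ω} ≠ 0) (T : ℝ≥0) :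
    K * T * (1 - Real.log K) ≤ expectedLagrangian G X μ T ω :=
  sub_nonneg.1 <| ge_of_tendsto'
    (hX.tendsto_occupationSum_jumpEntropy hp hG hK hGK hω T) fun n =>
    mul_nonneg hK.le (occupationSum_nonneg hp ω T (jumpEntropy_nonneg hp hG hK hGK) n)

lemma IsMarkovJumpProcess.expectedLagrangian_eq (hp : IsTransitionFunction p)
    (hG : IsGenerator p G) (hK : 0 < K) (hGK : ∀ a, |elem G a a| = K)
    (hX : IsMarkovJumpProcess p X μ) {ω : S} (hω : μ {x | X 0 x = ω} ≠ 0) (T : ℝ≥0)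
    (h : ∀ a, Relation.ReflTransGen (CanJump G) ω a → JumpsDeterministically G a) :
    expectedLagrangian G X μ T ω = K * T * (1 - Real.log K) := by
  have h0 : ∀ n, occupationSum p ω T (jumpEntropy G K) n = 0 := fun n =>
    occupationSum_eq_zero ω T n fun t a => by
      by_cases ha : Relation.ReflTransGen (CanJump G) ω a
      · rw [(jumpEntropy_eq_zero_iff hp hG hK hGK a).2 (h a ha), mul_zero]
      · rw [hp.eq_zero_of_not_reflTransGen hG ha, zero_mul]
  have h1 := hX.tendsto_occupationSum_jumpEntropy hp hG hK hGK hω T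
  simp_rw [h0, mul_zero] at h1
  exact sub_eq_zero.1 (tendsto_nhds_unique h1 tendsto_const_nhds)

lemma IsMarkovJumpProcess.expectedLagrangian_eq_iff (hp : IsTransitionFunction p)
    (hG : IsGenerator p G) (hK : 0 < K) (hGK : ∀ a, |elem G a a| = K)
    (hX : IsMarkovJumpProcess p X μ) {ω : S} (hω : μ {x | X 0 x = ω} ≠ 0) {T : ℝ≥0} (hT : 0 < T) :
    expectedLagrangian G X μ T ω = K * T * (1 - Real.log K) ↔
      ∀ a, Relation.ReflTransGen (CanJump G) ω a → JumpsDeterministically G a := by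
  refine ⟨fun heq a ha => ?_, hX.expectedLagrangian_eq hp hG hK hGK hω T⟩
  by_contra hdet
  have hnonneg := jumpEntropy_nonneg hp hG hK hGK
  have hpos : 0 < jumpEntropy G K a := (hnonneg a).lt_of_ne' fun h0 =>
    hdet ((jumpEntropy_eq_zero_iff hp hG hK hGK a).1 h0)
  obtain ⟨ε, hε, hle⟩ := exists_le_occupationSum hp hG ha hT hnonneg hpos
  have h1 := (hX.tendsto_occupationSum_jumpEntropy hp hG hK hGK hω T).comp (tendsto_add_atTop_nat 1)
  rw [heq, sub_self] at h1
  have h2 := ge_of_tendsto' h1 fun n => mul_le_mul_of_nonneg_left (hle n) hK.le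
  exact (mul_pos hK hε).not_ge h2

end Dynamics

end StochasticField

theorem mainTheorem9 {S : Type*} [Fintype S] [DecidableEq S] [TopologicalSpace S]
    [DiscreteTopology S] [MeasurableSpace S] [MeasurableSingletonClass S]
    (p : ℝ≥0 → S → S → ℝ) (hp : StochasticField.IsTransitionFunction p)
    (G : StochasticField.Hilb S →L[ℝ] StochasticField.Hilb S)
    (hG : StochasticField.IsGenerator p G)
    (K : ℝ) (hK : 0 < K) (hGK : ∀ ω, |StochasticField.elem G ω ω| = K) :
    -- the rates divided by `K` form a probability distribution
    (∀ ω, (∀ ω', ω' ≠ ω → 0 ≤ StochasticField.elem G ω' ω / K) ∧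
      ∑ ω' ∈ Finset.univ.erase ω, StochasticField.elem G ω' ω / K = 1) ∧
    -- the entropy identity
    (∀ ω, StochasticField.lagrangianOp G
        (StochasticField.liftedGenerator G (StochasticField.ket ω)) =
      -K * Real.log K + K * StochasticField.jumpEntropy G K ω) ∧
    -- the expected integral of the Lagrangian of the process
    ∀ {E : Type*} [MeasurableSpace E] (μ : Measure E) [IsProbabilityMeasure μ]
      (X : ℝ≥0 → E → S), StochasticField.IsMarkovJumpProcess p X μ → ∀ T : ℝ≥0,
      (∀ ω, μ {x | X 0 x = ω} ≠ 0 →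
        Integrable (fun x => StochasticField.lagrangianIntegral G T fun t => X t x)
          (ProbabilityTheory.cond μ {x | X 0 x = ω}) ∧
        K * T * (1 - Real.log K) ≤ StochasticField.expectedLagrangian G X μ T ω ∧
        ((∀ ω', StochasticField.JumpsDeterministically G ω') →
          StochasticField.expectedLagrangian G X μ T ω = K * T * (1 - Real.log K)) ∧
        (0 < T →
          (StochasticField.expectedLagrangian G X μ T ω = K * T * (1 - Real.log K) ↔
            ∀ ω', Relation.ReflTransGen (StochasticField.CanJump G) ω ω' →
              StochasticField.JumpsDeterministically G ω'))) ∧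
      (0 < T → (∀ ω, μ {x | X 0 x = ω} ≠ 0) →
        ((∀ ω, StochasticField.expectedLagrangian G X μ T ω = K * T * (1 - Real.log K)) ↔
          ∀ ω, StochasticField.JumpsDeterministically G ω)) := by
  refine ⟨fun ω => ⟨fun ω' h => StochasticField.jumpProb_nonneg hp hG hK h,
      StochasticField.sum_jumpProb hp hG hK hGK ω⟩,
    fun ω => ?_, fun {E} _ μ _ X hX T => ⟨fun ω hω => ⟨?_, ?_, fun h => ?_, fun hT => ?_⟩,
      fun hT hω => ⟨fun h ω => ?_, fun h ω => ?_⟩⟩⟩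
  · rw [StochasticField.lagrangianOp_liftedGenerator_ket,
      StochasticField.sum_jumpCost_mul_elem hp hG hK hGK]
    ring
  · exact hX.integrable_lagrangianIntegral hp hG hGK hω T
  · exact hX.le_expectedLagrangian hp hG hK hGK hω T
  · exact hX.expectedLagrangian_eq hp hG hK hGK hω T fun a _ => h a
  · exact hX.expectedLagrangian_eq_iff hp hG hK hGK hω hT
  · exact (hX.expectedLagrangian_eq_iff hp hG hK hGK (hω ω) hT).1 (h ω) ω .refl
  · exact hX.expectedLagrangian_eq hp hG hK hGK (hω ω) T fun a _ => h a
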